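/- Let $n\ge 1$ and let $A\in\mathbb C^{n\times n}$ be a matrix all of whose eigenvalues are simple (algebraic multiplicity one). Write $\Lambda(\cdot)$ for the set of eigenvalues, $\|\cdot\|_2$ for the matrix 2-norm, $B_\rho(z)$ for the open disc of radius $\rho$ centred at $z\in\mathbb C$, and for $\varepsilon>0$ put $$\Lambda_\varepsilon(A)=\bigcup_{\|\Delta\|_2\le\varepsilon}\Lambda(A+\Delta),\qquad \alpha_\varepsilon(A)=\max\{\operatorname{Re} z : z\in\Lambda_\varepsilon(A)\}.$$ Call $\varepsilon>0$ sufficiently small if there are an open interval $U\subset\mathbb R$ with $[0,\varepsilon]\subset U$ and radii $r(\mu_0)>0$ for $\mu_0\in\Lambda(A)$ such that for every $\mu_0\in\Lambda(A)$, every $\eta\in U$ and every $\Delta\in\mathbb C^{n\times n}$ with $\|\Delta\|_2\le1$, the matrix $A+\eta\Delta$ has exactly one eigenvalue in $B_{r(\mu_0)}(\mu_0)$, and this eigenvalue is simple. Denote it by $\mu(\eta;\Delta,\mu_0)$ and put $$\mathcal R(\varepsilon;\mu_0)=\max_{\|\Delta\|_2\le1}\operatorname{Re}\mu(\varepsilon;\Delta,\mu_0).$$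 Then there is $\varepsilon_0>0$ such that every $\varepsilon\in(0,\varepsilon_0]$ is sufficiently small. Moreover, for every sufficiently small $\varepsilon$ and every such choice of $U$ and $r$, all the maxima exist and $$\alpha_\varepsilon(A)=\max_{\mu_0\in\Lambda(A)}\mathcal R(\varepsilon;\mu_0)=\max_{\mu_0\in\Lambda(A)}\left\{\operatorname{Re}\mu_0+\frac{\varepsilon}{|y_{\mu_0}^*x_{\mu_0}|}\right\}+\mathcal O(\varepsilon^2),$$ where $x_{\mu_0}$ and $y_{\mu_0}$ are a unit right and a unit left eigenvector of $A$ for $\mu_0$ (that is, $Ax_{\mu_0}=\mu_0x_{\mu_0}$, $y_{\mu_0}^*A=\mu_0y_{\mu_0}^*$), and the $\mathcal O(\varepsilon^2)$ term is bounded in absolute value by $C\varepsilon^2$ with a constant $C$ depending only on $A$. -/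

import Mathlib

open scoped Matrix

-- `‖Δ‖` for a matrix `Δ` is the 2-norm (the operator norm induced by the Euclidean norm).
open scoped Matrix.Norms.L2Operator

noncomputable section

namespace PsAbscissa

variable {n : ℕ}

/-- The `ε`-pseudospectrum: all eigenvalues of the matrices `A + Δ` with `‖Δ‖₂ ≤ ε`. -/
def pseudospectrum (A : Matrix (Fin n) (Fin n) ℂ) (ε : ℝ) : Set ℂ :=
  {z | ∃ Δ : Matrix (Fin n) (Fin n) ℂ, ‖Δ‖ ≤ ε ∧ z ∈ spectrum ℂ (A + Δ)}

/-- The `ε`-pseudospectral abscissa (the theorem also asserts that the supremum is attained). -/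
def pseudospectralAbscissa (A : Matrix (Fin n) (Fin n) ℂ) (ε : ℝ) : ℝ :=
  sSup (Complex.re '' pseudospectrum A ε)

/-- `z` is an eigenvalue of `A` of algebraic multiplicity one. -/
def IsSimpleEigenvalue (A : Matrix (Fin n) (Fin n) ℂ) (z : ℂ) : Prop :=
  z ∈ spectrum ℂ A ∧ A.charpoly.rootMultiplicity z = 1

/-- `ε > 0` is sufficiently small, as witnessed by an open interval `U ⊇ [0, ε]` and radii `r μ₀ > 0`:
for every `η ∈ U` and `‖Δ‖₂ ≤ 1`, the matrix `A + η Δ` has exactly one eigenvalue in the open ball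
of radius `r μ₀` around each eigenvalue `μ₀` of `A`, and this eigenvalue is simple. -/
structure IsSufficientlySmall (A : Matrix (Fin n) (Fin n) ℂ) (ε : ℝ) (U : Set ℝ) (r : ℂ → ℝ) :
    Prop where
  pos : 0 < ε
  isOpen : IsOpen U
  ordConnected : U.OrdConnected
  subset : Set.Icc 0 ε ⊆ U
  radius_pos : ∀ μ₀ ∈ spectrum ℂ A, 0 < r μ₀
  unique_simple : ∀ μ₀ ∈ spectrum ℂ A, ∀ η ∈ U, ∀ Δ : Matrix (Fin n) (Fin n) ℂ, ‖Δ‖ ≤ 1 →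
    ∃ z : ℂ, spectrum ℂ (A + (η : ℂ) • Δ) ∩ Metric.ball μ₀ (r μ₀) = {z} ∧
      IsSimpleEigenvalue (A + (η : ℂ) • Δ) z

/-- `μ(η; Δ, μ₀)`: the eigenvalue of `A + η Δ` in the open ball of radius `ρ` around `μ₀`
(an arbitrary value if there is none; used only where there is exactly one). -/
def eigBranch (A : Matrix (Fin n) (Fin n) ℂ) (ρ : ℝ) (η : ℝ) (Δ : Matrix (Fin n) (Fin n) ℂ)
    (μ₀ : ℂ) : ℂ :=
  Classical.epsilon fun z : ℂ => z ∈ spectrum ℂ (A + (η : ℂ) • Δ) ∩ Metric.ball μ₀ ρ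

/-- The real parts `Re μ(ε; Δ, μ₀)`, over all `Δ` with `‖Δ‖₂ ≤ 1`. -/
def branchReals (A : Matrix (Fin n) (Fin n) ℂ) (ρ : ℝ) (ε : ℝ) (μ₀ : ℂ) : Set ℝ :=
  {t | ∃ Δ : Matrix (Fin n) (Fin n) ℂ, ‖Δ‖ ≤ 1 ∧ t = (eigBranch A ρ ε Δ μ₀).re}

/-- `R(ε; μ₀) = max {Re μ(ε; Δ, μ₀) : ‖Δ‖₂ ≤ 1}` (the theorem also asserts that the supremum is
attained). -/
def rightmostReal (A : Matrix (Fin n) (Fin n) ℂ) (ρ : ℝ) (ε : ℝ) (μ₀ : ℂ) : ℝ :=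
  sSup (branchReals A ρ ε μ₀)

/-- `x` is a unit right eigenvector: `A x = μ₀ x`, `‖x‖₂ = 1`. -/
def IsUnitRightEigenvector (A : Matrix (Fin n) (Fin n) ℂ) (μ₀ : ℂ)
    (x : EuclideanSpace ℂ (Fin n)) : Prop :=
  ‖x‖ = 1 ∧ A *ᵥ x.ofLp = μ₀ • x.ofLp

/-- `y` is a unit left eigenvector: `y* A = μ₀ y*`, `‖y‖₂ = 1`. -/
def IsUnitLeftEigenvector (A : Matrix (Fin n) (Fin n) ℂ) (μ₀ : ℂ)
    (y : EuclideanSpace ℂ (Fin n)) : Prop :=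
  ‖y‖ = 1 ∧ star y.ofLp ᵥ* A = μ₀ • star y.ofLp

end PsAbscissa

end

namespace PsAbscissa

open Filter Topology

variable {n : ℕ}

/-! First equality: for fixed `Δ` in the unit ball the branches are continuous in `η`, and
uniqueness in each disc makes the set where two branches agree open and closed in the interval `U`.
Distinct at `η = 0`, they stay distinct (`eigBranch_injOn`), so the `n` branches exhaust the `n`
eigenvalues of `A + η Δ` (`exists_eq_eigBranch`). Compactness of the unit ball of matrices gives the
maxima.

Second equality: no derivative of a branch is taken; `α_ε` is compared directly with the
pseudospectrum. The eigenvectors form a basis with biorthogonal left eigenvectors, and pairing `A v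
+ u = z v` with `y_ν` gives `(z - ν) y_ν* v = y_ν* u`. Near `μ` the components of `v` along the
other eigenvectors are therefore small. This bounds `|z - μ|` above
(`exists_norm_sub_le_of_mem_pseudospectrum`); conversely, `v = (z - A)⁻¹ y_μ` certifies a point `z`
far enough to the right of `μ` (`exists_mem_pseudospectrum_re_ge`). -/

/-! ### Stability of simple eigenvalues under perturbation -/

theorem pow_card_le_norm_prod_sub {s : Multiset ℂ} {z : ℂ} {ρ : ℝ} (hρ : 0 ≤ ρ)
    (h : ∀ w ∈ s, ρ ≤ ‖z - w‖) : ρ ^ s.card ≤ ‖(s.map fun w => z - w).prod‖ := by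
  induction s using Multiset.induction_on with
  | empty => simp
  | cons a s ih =>
    rw [Multiset.card_cons, Multiset.map_cons, Multiset.prod_cons, norm_mul, pow_succ']
    exact mul_le_mul (h a (Multiset.mem_cons_self a s))
      (ih fun w hw => h w (Multiset.mem_cons_of_mem hw)) (by positivity) (norm_nonneg _)

theorem card_roots_charpoly (B : Matrix (Fin n) (Fin n) ℂ) : B.charpoly.roots.card = n := by
  rw [IsAlgClosed.card_roots_eq_natDegree, Matrix.charpoly_natDegree_eq_dim, Fintype.card_fin]

theorem mem_roots_charpoly {B : Matrix (Fin n) (Fin n) ℂ} {z : ℂ} :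
    z ∈ B.charpoly.roots ↔ z ∈ spectrum ℂ B := by
  rw [Polynomial.mem_roots (Matrix.charpoly_monic B).ne_zero,
    Matrix.mem_spectrum_iff_isRoot_charpoly]

/-- The value at `z` is a product of `n` factors `z - w` over the eigenvalues `w`; if all have
modulus at least `ρ`, so does the product with `ρ ^ n`. -/
theorem exists_mem_spectrum_of_norm_eval_charpoly_lt {B : Matrix (Fin n) (Fin n) ℂ} {z : ℂ} {ρ : ℝ}
    (hρ : 0 ≤ ρ) (h : ‖B.charpoly.eval z‖ < ρ ^ n) : ∃ w ∈ spectrum ℂ B, ‖z - w‖ < ρ := by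
  by_contra! hc
  have h1 := pow_card_le_norm_prod_sub (s := B.charpoly.roots) (z := z) hρ
    fun w hw => hc w (mem_roots_charpoly.1 hw)
  rw [card_roots_charpoly] at h1
  rw [(IsAlgClosed.splits B.charpoly).eval_eq_prod_roots, (Matrix.charpoly_monic B).leadingCoeff,
    one_mul] at h
  exact absurd h (not_lt.2 h1)

theorem continuous_eval_charpoly (z : ℂ) :
    Continuous fun B : Matrix (Fin n) (Fin n) ℂ => B.charpoly.eval z := by
  simp only [Matrix.eval_charpoly]
  exact (continuous_const.sub continuous_id).matrix_det

/-- Eigenvalues depend lower semicontinuously on the matrix. -/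
theorem eventually_exists_mem_spectrum {B : Matrix (Fin n) (Fin n) ℂ} {z : ℂ}
    (hz : z ∈ spectrum ℂ B) {ρ : ℝ} (hρ : 0 < ρ) :
    ∀ᶠ B' in 𝓝 B, ∃ w ∈ spectrum ℂ B', w ∈ Metric.ball z ρ := by
  have h0 : B.charpoly.eval z = 0 := Matrix.mem_spectrum_iff_isRoot_charpoly.1 hz
  have h1 : ∀ᶠ B' in 𝓝 B, ‖B'.charpoly.eval z‖ < ρ ^ n :=
    ((continuous_eval_charpoly z).norm.tendsto B).eventually_lt_const
      (by rw [h0, norm_zero]; positivity)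
  filter_upwards [h1] with B' hB'
  obtain ⟨w, hw, hlt⟩ := exists_mem_spectrum_of_norm_eval_charpoly_lt hρ.le hB'
  exact ⟨w, hw, by rwa [Metric.mem_ball, dist_comm, dist_eq_norm]⟩

/-- A matrix of size `n` with an injective family of `n` eigenvalues has no others. -/
theorem roots_charpoly_eq_of_injOn {B : Matrix (Fin n) (Fin n) ℂ} {S : Finset ℂ} {f : ℂ → ℂ}
    (hS : S.card = n) (hf : Set.InjOn f S) (hmem : ∀ μ ∈ S, f μ ∈ spectrum ℂ B) :
    B.charpoly.roots = (S.image f).val := by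
  have hcard : (S.image f).card = n := by rw [Finset.card_image_of_injOn hf, hS]
  refine (Multiset.eq_of_le_of_card_le (Multiset.le_iff_subset (S.image f).nodup |>.2 ?_) ?_).symm
  · intro w hw
    obtain ⟨μ, hμ, rfl⟩ := Finset.mem_image.1 (Finset.mem_def.2 hw)
    exact mem_roots_charpoly.2 (hmem μ hμ)
  · rw [card_roots_charpoly, Finset.card_val, hcard]

theorem card_toFinset_roots {A : Matrix (Fin n) (Fin n) ℂ}
    (hA : ∀ μ₀ ∈ spectrum ℂ A, IsSimpleEigenvalue A μ₀) : A.charpoly.roots.toFinset.card = n := by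
  rw [Multiset.toFinset_card_of_nodup, card_roots_charpoly]
  rw [Multiset.nodup_iff_count_le_one]
  intro z
  by_cases hz : z ∈ spectrum ℂ A
  · rw [Polynomial.count_roots, (hA z hz).2]
  · rw [Multiset.count_eq_zero_of_notMem (mt mem_roots_charpoly.1 hz)]
    exact zero_le_one

theorem mem_toFinset_roots {A : Matrix (Fin n) (Fin n) ℂ} {z : ℂ} :
    z ∈ A.charpoly.roots.toFinset ↔ z ∈ spectrum ℂ A := by
  rw [Multiset.mem_toFinset, mem_roots_charpoly]

theorem norm_smul_le_of_norm_le_one {Δ : Matrix (Fin n) (Fin n) ℂ} (hΔ : ‖Δ‖ ≤ 1) (η : ℝ) :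
    ‖(η : ℂ) • Δ‖ ≤ |η| := by
  rw [norm_smul, Complex.norm_real, Real.norm_eq_abs]
  exact mul_le_of_le_one_right (abs_nonneg η) hΔ

/-- A positive lower bound for the distances within a finite set. -/
theorem exists_pos_le_dist (S : Finset ℂ) :
    ∃ g > 0, ∀ μ ∈ S, ∀ ν ∈ S, μ ≠ ν → g ≤ dist μ ν := by
  rcases (S.offDiag).eq_empty_or_nonempty with h | h
  · refine ⟨1, one_pos, fun μ hμ ν hν hne => ?_⟩
    have : (μ, ν) ∈ S.offDiag := Finset.mem_offDiag.2 ⟨hμ, hν, hne⟩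
    simp [h] at this
  · obtain ⟨p, hp, hmin⟩ := Finset.exists_min_image S.offDiag (fun p => dist p.1 p.2) h
    exact ⟨dist p.1 p.2, dist_pos.2 (Finset.mem_offDiag.1 hp).2.2, fun μ hμ ν hν hne =>
      hmin (μ, ν) (Finset.mem_offDiag.2 ⟨hμ, hν, hne⟩)⟩

/-- Discs of radius half the eigenvalue gap `g` are disjoint. Each keeps at least one eigenvalue
under small perturbation; with `n` discs and `n` roots counted with multiplicity, each holds exactly
one, and it is simple. -/
theorem exists_isSufficientlySmall {A : Matrix (Fin n) (Fin n) ℂ}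
    (hA : ∀ μ₀ ∈ spectrum ℂ A, IsSimpleEigenvalue A μ₀) :
    ∃ ε₀ : ℝ, 0 < ε₀ ∧ ∀ ε : ℝ, 0 < ε → ε ≤ ε₀ →
      ∃ (U : Set ℝ) (r : ℂ → ℝ), IsSufficientlySmall A ε U r := by
  obtain ⟨g, hg, hsep⟩ := exists_pos_le_dist A.charpoly.roots.toFinset
  have hev : ∀ᶠ B in 𝓝 A, ∀ μ ∈ A.charpoly.roots.toFinset,
      ∃ w ∈ spectrum ℂ B, w ∈ Metric.ball μ (g / 2) :=
    (Finset.eventually_all _).2 fun μ hμ =>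
      eventually_exists_mem_spectrum (mem_toFinset_roots.1 hμ) (half_pos hg)
  obtain ⟨δ, hδ, hball⟩ := Metric.eventually_nhds_iff.1 hev
  refine ⟨δ / 2, half_pos hδ, fun ε hε hεδ => ⟨Set.Ioo (-δ) δ, fun _ => g / 2, hε, isOpen_Ioo,
    Set.ordConnected_Ioo, fun η hη => ⟨by linarith [hη.1], by linarith [hη.2]⟩,
    fun _ _ => half_pos hg, ?_⟩⟩
  intro μ₀ hμ₀ η hη Δ hΔ
  have hd : dist (A + (η : ℂ) • Δ) A < δ := by
    rw [dist_eq_norm, add_sub_cancel_left]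
    exact (norm_smul_le_of_norm_le_one hΔ η).trans_lt (abs_lt.2 hη)
  have hB := hball hd
  choose! f hf hfb using hB
  have hinj : ∀ μ ∈ A.charpoly.roots.toFinset, ∀ ν ∈ A.charpoly.roots.toFinset,
      f μ ∈ Metric.ball ν (g / 2) → μ = ν := by
    intro μ hμ ν hν h
    by_contra hne
    have h1 := hsep μ hμ ν hν hne
    have h2 := Metric.mem_ball'.1 (hfb μ hμ)
    have h3 := Metric.mem_ball.1 h
    linarith [dist_triangle μ (f μ) ν]
  have hroots := roots_charpoly_eq_of_injOn (card_toFinset_roots hA)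
    (fun μ hμ ν hν h => hinj μ hμ ν hν (by rw [h]; exact hfb ν hν)) hf
  have hm := mem_toFinset_roots.2 hμ₀
  refine ⟨f μ₀, ?_, hf μ₀ hm, ?_⟩
  · ext w
    constructor
    · rintro ⟨hw, hwb⟩
      rw [← mem_roots_charpoly, hroots, Finset.mem_val, Finset.mem_image] at hw
      obtain ⟨μ, hμ, rfl⟩ := hw
      rw [hinj μ hμ μ₀ hm hwb]
      rfl
    · rintro rfl
      exact ⟨hf μ₀ hm, hfb μ₀ hm⟩
  · rw [← Polynomial.count_roots, hroots]
    exact Multiset.count_eq_one_of_mem (Finset.nodup _) (Finset.mem_image_of_mem f hm)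

theorem spectrum_nonempty (hn : 0 < n) (A : Matrix (Fin n) (Fin n) ℂ) : (spectrum ℂ A).Nonempty := by
  have h : A.charpoly.roots ≠ 0 := by
    rw [ne_eq, ← Multiset.card_eq_zero, card_roots_charpoly]
    exact hn.ne'
  obtain ⟨z, hz⟩ := Multiset.exists_mem_of_ne_zero h
  exact ⟨z, mem_roots_charpoly.1 hz⟩

theorem isGreatest_image_spectrum (hn : 0 < n) (A : Matrix (Fin n) (Fin n) ℂ) (f : ℂ → ℝ) :
    ∃ M, IsGreatest (f '' spectrum ℂ A) M := by
  obtain ⟨μ, hμ, hmax⟩ := Set.exists_max_image _ f A.finite_spectrum (spectrum_nonempty hn A)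
  exact ⟨f μ, ⟨μ, hμ, rfl⟩, by rintro _ ⟨ν, hν, rfl⟩; exact hmax ν hν⟩

/-! ### Eigenvalue branches and the first equality -/

namespace IsSufficientlySmall

variable {A : Matrix (Fin n) (Fin n) ℂ} {ε : ℝ} {U : Set ℝ} {r : ℂ → ℝ}

theorem inter_ball_eq (hs : IsSufficientlySmall A ε U r) {μ₀ : ℂ} (hμ₀ : μ₀ ∈ spectrum ℂ A) {η : ℝ}
    (hη : η ∈ U) {Δ : Matrix (Fin n) (Fin n) ℂ} (hΔ : ‖Δ‖ ≤ 1) :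
    spectrum ℂ (A + (η : ℂ) • Δ) ∩ Metric.ball μ₀ (r μ₀) = {eigBranch A (r μ₀) η Δ μ₀} := by
  obtain ⟨z, hz, -⟩ := hs.unique_simple μ₀ hμ₀ η hη Δ hΔ
  have h : eigBranch A (r μ₀) η Δ μ₀ ∈ spectrum ℂ (A + (η : ℂ) • Δ) ∩ Metric.ball μ₀ (r μ₀) :=
    Classical.epsilon_spec (p := fun z => z ∈ spectrum ℂ (A + (η : ℂ) • Δ) ∩ Metric.ball μ₀ (r μ₀))
      ⟨z, hz ▸ rfl⟩
  rw [hz] at h ⊢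
  rw [Set.mem_singleton_iff.1 h]

theorem eigBranch_mem (hs : IsSufficientlySmall A ε U r) {μ₀ : ℂ} (hμ₀ : μ₀ ∈ spectrum ℂ A) {η : ℝ}
    (hη : η ∈ U) {Δ : Matrix (Fin n) (Fin n) ℂ} (hΔ : ‖Δ‖ ≤ 1) :
    eigBranch A (r μ₀) η Δ μ₀ ∈ spectrum ℂ (A + (η : ℂ) • Δ) ∩ Metric.ball μ₀ (r μ₀) :=
  hs.inter_ball_eq hμ₀ hη hΔ ▸ rfl

theorem eq_eigBranch (hs : IsSufficientlySmall A ε U r) {μ₀ : ℂ} (hμ₀ : μ₀ ∈ spectrum ℂ A) {η : ℝ}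
    (hη : η ∈ U) {Δ : Matrix (Fin n) (Fin n) ℂ} (hΔ : ‖Δ‖ ≤ 1) {w : ℂ}
    (hw : w ∈ spectrum ℂ (A + (η : ℂ) • Δ)) (hwb : w ∈ Metric.ball μ₀ (r μ₀)) :
    w = eigBranch A (r μ₀) η Δ μ₀ := by
  have h : w ∈ spectrum ℂ (A + (η : ℂ) • Δ) ∩ Metric.ball μ₀ (r μ₀) := ⟨hw, hwb⟩
  rwa [hs.inter_ball_eq hμ₀ hη hΔ] at h

theorem continuousOn_eigBranch (hs : IsSufficientlySmall A ε U r) {μ₀ : ℂ}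
    (hμ₀ : μ₀ ∈ spectrum ℂ A) :
    ContinuousOn (fun p : ℝ × Matrix (Fin n) (Fin n) ℂ => eigBranch A (r μ₀) p.1 p.2 μ₀)
      (U ×ˢ Metric.closedBall 0 1) := by
  rintro p ⟨hp1, hp2⟩
  rw [mem_closedBall_zero_iff] at hp2
  obtain ⟨hz, hzb⟩ := hs.eigBranch_mem hμ₀ hp1 hp2
  set z := eigBranch A (r μ₀) p.1 p.2 μ₀ with hzdef
  rw [ContinuousWithinAt, Metric.tendsto_nhds]
  intro ρ hρ
  have hcont : Continuous fun p : ℝ × Matrix (Fin n) (Fin n) ℂ => A + (p.1 : ℂ) • p.2 := by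
    fun_prop
  -- The second radius keeps the nearby eigenvalue inside the disc around `μ₀`, where uniqueness
  -- identifies it with the branch.
  have hev := (hcont.tendsto p).eventually
    (eventually_exists_mem_spectrum hz (lt_min hρ (sub_pos.2 (Metric.mem_ball.1 hzb))))
  filter_upwards [hev.filter_mono nhdsWithin_le_nhds, self_mem_nhdsWithin] with q ⟨w, hw, hwb⟩ hq
  have hw1 : w ∈ Metric.ball μ₀ (r μ₀) :=
    Metric.ball_subset (by linarith [min_le_right ρ (r μ₀ - dist z μ₀)]) hwb
  rw [← hs.eq_eigBranch hμ₀ hq.1 (mem_closedBall_zero_iff.1 hq.2) hw hw1]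
  exact (Metric.mem_ball.1 hwb).trans_le (min_le_left _ _)

theorem continuousOn_eigBranch_right (hs : IsSufficientlySmall A ε U r) {μ₀ : ℂ}
    (hμ₀ : μ₀ ∈ spectrum ℂ A) {η : ℝ} (hη : η ∈ U) :
    ContinuousOn (fun Δ => eigBranch A (r μ₀) η Δ μ₀) (Metric.closedBall 0 1) :=
  (hs.continuousOn_eigBranch hμ₀).comp (f := fun Δ : Matrix (Fin n) (Fin n) ℂ => (η, Δ))
    (Continuous.prodMk_right η).continuousOn fun _ hΔ => ⟨hη, hΔ⟩

theorem continuousOn_eigBranch_left (hs : IsSufficientlySmall A ε U r) {μ₀ : ℂ}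
    (hμ₀ : μ₀ ∈ spectrum ℂ A) {Δ : Matrix (Fin n) (Fin n) ℂ} (hΔ : ‖Δ‖ ≤ 1) :
    ContinuousOn (fun η => eigBranch A (r μ₀) η Δ μ₀) U :=
  (hs.continuousOn_eigBranch hμ₀).comp (f := fun η : ℝ => (η, Δ))
    (Continuous.prodMk_left Δ).continuousOn fun _ hη => ⟨hη, mem_closedBall_zero_iff.2 hΔ⟩

theorem zero_mem (hs : IsSufficientlySmall A ε U r) : (0 : ℝ) ∈ U :=
  hs.subset ⟨le_rfl, hs.pos.le⟩

theorem mem (hs : IsSufficientlySmall A ε U r) : ε ∈ U :=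
  hs.subset ⟨hs.pos.le, le_rfl⟩

theorem eigBranch_zero (hs : IsSufficientlySmall A ε U r) {μ₀ : ℂ} (hμ₀ : μ₀ ∈ spectrum ℂ A)
    {Δ : Matrix (Fin n) (Fin n) ℂ} (hΔ : ‖Δ‖ ≤ 1) : eigBranch A (r μ₀) 0 Δ μ₀ = μ₀ :=
  (hs.eq_eigBranch hμ₀ hs.zero_mem hΔ (by simpa using hμ₀)
    (Metric.mem_ball_self (hs.radius_pos μ₀ hμ₀))).symm

/-- Branches that start at distinct eigenvalues never meet. -/
theorem eigBranch_injOn (hs : IsSufficientlySmall A ε U r) {Δ : Matrix (Fin n) (Fin n) ℂ}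
    (hΔ : ‖Δ‖ ≤ 1) {η : ℝ} (hη : η ∈ U) :
    Set.InjOn (fun μ₀ => eigBranch A (r μ₀) η Δ μ₀) (spectrum ℂ A) := by
  intro μ hμ ν hν heq
  set F : ℂ → U → ℂ := fun μ η => eigBranch A (r μ) η Δ μ with hF
  have hFc : ∀ μ ∈ spectrum ℂ A, Continuous (F μ) := fun μ hμ =>
    continuousOn_iff_continuous_domRestrict.1 (hs.continuousOn_eigBranch_left hμ hΔ)
  have : PreconnectedSpace U := Subtype.preconnectedSpace hs.ordConnected.isPreconnected
  have hclopen : IsClopen {t : U | F μ t = F ν t} := by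
    -- Openness: near a meeting point the branch from `μ` stays in the disc around `ν`, whose only
    -- eigenvalue is the branch from `ν`.
    refine ⟨isClosed_eq (hFc μ hμ) (hFc ν hν), isOpen_iff_mem_nhds.2 fun t ht => ?_⟩
    have hb : F μ t ∈ Metric.ball ν (r ν) := by
      rw [show F μ t = F ν t from ht]
      exact (hs.eigBranch_mem hν t.2 hΔ).2
    filter_upwards [(hFc μ hμ).continuousAt (Metric.isOpen_ball.mem_nhds hb)] with s hs'
    exact hs.eq_eigBranch hν s.2 hΔ (hs.eigBranch_mem hμ s.2 hΔ).1 hs'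
  rcases isClopen_iff.1 hclopen with h | h
  · exact absurd (show (⟨η, hη⟩ : U) ∈ {t : U | F μ t = F ν t} from heq) (by simp [h])
  · have h0 : (⟨0, hs.zero_mem⟩ : U) ∈ {t : U | F μ t = F ν t} := h ▸ Set.mem_univ _
    have h1 : eigBranch A (r μ) 0 Δ μ = eigBranch A (r ν) 0 Δ ν := h0
    rwa [hs.eigBranch_zero hμ hΔ, hs.eigBranch_zero hν hΔ] at h1

theorem exists_eq_eigBranch (hs : IsSufficientlySmall A ε U r)
    (hA : ∀ μ₀ ∈ spectrum ℂ A, IsSimpleEigenvalue A μ₀) {Δ : Matrix (Fin n) (Fin n) ℂ}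
    (hΔ : ‖Δ‖ ≤ 1) {η : ℝ} (hη : η ∈ U) {z : ℂ} (hz : z ∈ spectrum ℂ (A + (η : ℂ) • Δ)) :
    ∃ μ₀ ∈ spectrum ℂ A, z = eigBranch A (r μ₀) η Δ μ₀ := by
  have hroots := roots_charpoly_eq_of_injOn (card_toFinset_roots hA)
    (f := fun μ₀ => eigBranch A (r μ₀) η Δ μ₀)
    ((hs.eigBranch_injOn hΔ hη).mono fun μ hμ => mem_toFinset_roots.1 hμ)
    (fun μ hμ => (hs.eigBranch_mem (mem_toFinset_roots.1 hμ) hη hΔ).1)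
  rw [← mem_roots_charpoly, hroots, Finset.mem_val, Finset.mem_image] at hz
  obtain ⟨μ, hμ, rfl⟩ := hz
  exact ⟨μ, mem_toFinset_roots.1 hμ, rfl⟩

theorem isGreatest_rightmostReal (hs : IsSufficientlySmall A ε U r) {μ₀ : ℂ}
    (hμ₀ : μ₀ ∈ spectrum ℂ A) :
    IsGreatest (branchReals A (r μ₀) ε μ₀) (rightmostReal A (r μ₀) ε μ₀) := by
  have heq : branchReals A (r μ₀) ε μ₀ =
      (fun Δ => (eigBranch A (r μ₀) ε Δ μ₀).re) '' Metric.closedBall 0 1 := by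
    ext t
    simp only [branchReals, Set.mem_ofPred_eq, Set.mem_image, mem_closedBall_zero_iff, eq_comm]
  have hc : IsCompact (branchReals A (r μ₀) ε μ₀) := by
    rw [heq]
    have : ProperSpace (Matrix (Fin n) (Fin n) ℂ) := FiniteDimensional.proper ℂ _
    exact (isCompact_closedBall 0 1).image_of_continuousOn
      (Complex.continuous_re.comp_continuousOn (hs.continuousOn_eigBranch_right hμ₀ hs.mem))
  exact hc.isGreatest_sSup ⟨_, 0, by simp, rfl⟩

theorem image_re_pseudospectrum (hs : IsSufficientlySmall A ε U r)
    (hA : ∀ μ₀ ∈ spectrum ℂ A, IsSimpleEigenvalue A μ₀) :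
    Complex.re '' pseudospectrum A ε = ⋃ μ₀ ∈ spectrum ℂ A, branchReals A (r μ₀) ε μ₀ := by
  have hε : (ε : ℂ) ≠ 0 := Complex.ofReal_ne_zero.2 hs.pos.ne'
  ext t
  simp only [Set.mem_image, Set.mem_iUnion, exists_prop]
  constructor
  · rintro ⟨z, ⟨Δ, hΔ, hz⟩, rfl⟩
    have hΔ1 : ‖(ε : ℂ)⁻¹ • Δ‖ ≤ 1 := by
      rw [norm_smul, norm_inv, Complex.norm_real, Real.norm_of_nonneg hs.pos.le,
        inv_mul_le_one₀ hs.pos]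
      exact hΔ
    have hz' : z ∈ spectrum ℂ (A + (ε : ℂ) • ((ε : ℂ)⁻¹ • Δ)) := by rwa [smul_inv_smul₀ hε]
    obtain ⟨μ₀, hμ₀, h⟩ := hs.exists_eq_eigBranch hA hΔ1 hs.mem hz'
    exact ⟨μ₀, hμ₀, _, hΔ1, by rw [h]⟩
  · rintro ⟨μ₀, hμ₀, Δ, hΔ, rfl⟩
    refine ⟨_, ⟨(ε : ℂ) • Δ, ?_, (hs.eigBranch_mem hμ₀ hs.mem hΔ).1⟩, rfl⟩
    simpa [abs_of_pos hs.pos] using norm_smul_le_of_norm_le_one hΔ ε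

theorem isGreatest_pseudospectralAbscissa (hn : 0 < n) (hs : IsSufficientlySmall A ε U r)
    (hA : ∀ μ₀ ∈ spectrum ℂ A, IsSimpleEigenvalue A μ₀) :
    IsGreatest (Complex.re '' pseudospectrum A ε) (pseudospectralAbscissa A ε) ∧
      IsGreatest ((fun μ₀ : ℂ => rightmostReal A (r μ₀) ε μ₀) '' spectrum ℂ A)
        (pseudospectralAbscissa A ε) := by
  obtain ⟨M, hM⟩ := isGreatest_image_spectrum hn A fun μ₀ => rightmostReal A (r μ₀) ε μ₀
  have h : IsGreatest (Complex.re '' pseudospectrum A ε) M := by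
    rw [hs.image_re_pseudospectrum hA]
    constructor
    · obtain ⟨μ, hμ, rfl⟩ := hM.1
      exact Set.mem_biUnion hμ (hs.isGreatest_rightmostReal hμ).1
    · intro t ht
      obtain ⟨μ, hμ, ht⟩ := Set.mem_iUnion₂.1 ht
      exact ((hs.isGreatest_rightmostReal hμ).2 ht).trans (hM.2 ⟨μ, hμ, rfl⟩)
  have hα : pseudospectralAbscissa A ε = M := h.csSup_eq
  rw [hα]
  exact ⟨h, hM⟩

end IsSufficientlySmall

/-! ### Eigenvectors, residuals and the pseudospectrum -/

theorem exists_eigenvector {B : Matrix (Fin n) (Fin n) ℂ} {z : ℂ} (hz : z ∈ spectrum ℂ B) :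
    ∃ v : EuclideanSpace ℂ (Fin n), v ≠ 0 ∧ B *ᵥ v.ofLp = z • v.ofLp := by
  have h0 : B.charpoly.eval z = 0 := Matrix.mem_spectrum_iff_isRoot_charpoly.1 hz
  rw [Matrix.eval_charpoly] at h0
  obtain ⟨v, hv, h⟩ := Matrix.exists_mulVec_eq_zero_iff.2 h0
  refine ⟨WithLp.toLp 2 v, by simpa using hv, ?_⟩
  rw [Matrix.sub_mulVec, sub_eq_zero, Matrix.scalar_apply, ← Matrix.smul_one_eq_diagonal,
    Matrix.smul_mulVec, Matrix.one_mulVec] at h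
  exact h.symm

theorem mem_spectrum_of_eigenvector {B : Matrix (Fin n) (Fin n) ℂ} {z : ℂ}
    {v : EuclideanSpace ℂ (Fin n)} (hv : v ≠ 0) (h : B *ᵥ v.ofLp = z • v.ofLp) :
    z ∈ spectrum ℂ B := by
  rw [Matrix.mem_spectrum_iff_isRoot_charpoly, Polynomial.IsRoot, Matrix.eval_charpoly]
  refine Matrix.exists_mulVec_eq_zero_iff.1 ⟨v.ofLp, by simpa using hv, ?_⟩
  rw [Matrix.sub_mulVec, Matrix.scalar_apply, ← Matrix.smul_one_eq_diagonal,
    Matrix.smul_mulVec, Matrix.one_mulVec, h, sub_self]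

theorem norm_toLp_mulVec_le (B : Matrix (Fin n) (Fin n) ℂ) (v : EuclideanSpace ℂ (Fin n)) :
    ‖WithLp.toLp 2 (B *ᵥ v.ofLp)‖ ≤ ‖B‖ * ‖v‖ :=
  Matrix.l2_opNorm_mulVec B v

theorem norm_le_of_mem_spectrum {B : Matrix (Fin n) (Fin n) ℂ} {z : ℂ} (hz : z ∈ spectrum ℂ B) :
    ‖z‖ ≤ ‖B‖ := by
  obtain ⟨v, hv, h⟩ := exists_eigenvector hz
  have h1 := norm_toLp_mulVec_le B v
  rw [h, WithLp.toLp_smul, WithLp.toLp_ofLp, norm_smul] at h1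
  exact le_of_mul_le_mul_right h1 (norm_pos_iff.2 hv)

theorem norm_le_of_mem_pseudospectrum {A : Matrix (Fin n) (Fin n) ℂ} {ε : ℝ} {z : ℂ}
    (hz : z ∈ pseudospectrum A ε) : ‖z‖ ≤ ‖A‖ + ε := by
  obtain ⟨Δ, hΔ, hz⟩ := hz
  linarith [norm_le_of_mem_spectrum hz, norm_add_le A Δ]

/-- The norm bound for a rank-one matrix `u v*`. -/
theorem norm_vecMulVec_star_le (u v : EuclideanSpace ℂ (Fin n)) :
    ‖Matrix.vecMulVec u.ofLp (star v.ofLp)‖ ≤ ‖u‖ * ‖v‖ := by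
  rw [Matrix.l2_opNorm_def]
  refine ContinuousLinearMap.opNorm_le_bound _ (by positivity) fun w => ?_
  have h : (Matrix.toEuclideanLin ≪≫ₗ LinearMap.toContinuousLinearMap)
      (Matrix.vecMulVec u.ofLp (star v.ofLp)) w = inner ℂ v w • u := by
    ext i
    rw [EuclideanSpace.inner_eq_star_dotProduct, dotProduct_comm]
    simp [Matrix.toEuclideanLin, Matrix.vecMulVec_mulVec, mul_comm]
  rw [h, norm_smul]
  nlinarith [norm_inner_le_norm (𝕜 := ℂ) v w, norm_nonneg u]

/-- An approximate eigenvector with relative residual at most `ε` certifies a point of the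
`ε`-pseudospectrum. -/
theorem mem_pseudospectrum_of_residual {A : Matrix (Fin n) (Fin n) ℂ} {ε : ℝ} {z : ℂ}
    {u v : EuclideanSpace ℂ (Fin n)} (hv : v ≠ 0) (h : A *ᵥ v.ofLp + u.ofLp = z • v.ofLp)
    (hu : ‖u‖ ≤ ε * ‖v‖) : z ∈ pseudospectrum A ε := by
  have hv0 : 0 < ‖v‖ := norm_pos_iff.2 hv
  -- The perturbation `u v* / ‖v‖²` sends `v` to `u` and has norm at most `‖u‖ / ‖v‖`.
  refine ⟨((‖v‖ : ℂ) ^ 2)⁻¹ • Matrix.vecMulVec u.ofLp (star v.ofLp), ?_, ?_⟩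
  · rw [norm_smul, norm_inv, norm_pow, Complex.norm_real, norm_norm, inv_mul_le_iff₀ (by positivity)]
    nlinarith [norm_vecMulVec_star_le u v]
  · refine mem_spectrum_of_eigenvector hv ?_
    have hvv : star v.ofLp ⬝ᵥ v.ofLp = (‖v‖ : ℂ) ^ 2 := by
      refine Eq.trans ?_ (inner_self_eq_norm_sq_to_K (𝕜 := ℂ) v)
      rw [EuclideanSpace.inner_eq_star_dotProduct,
        dotProduct_comm]
    have hne : (‖v‖ : ℂ) ≠ 0 := by simpa using hv
    rw [Matrix.add_mulVec, Matrix.smul_mulVec, Matrix.vecMulVec_mulVec, hvv, ← h]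
    congr 1
    ext i
    simp only [Pi.smul_apply, MulOpposite.smul_eq_mul_unop, MulOpposite.unop_op, smul_eq_mul]
    field_simp

theorem IsUnitLeftEigenvector.inner_mulVec {A : Matrix (Fin n) (Fin n) ℂ} {μ : ℂ}
    {y : EuclideanSpace ℂ (Fin n)} (hy : IsUnitLeftEigenvector A μ y)
    (v : EuclideanSpace ℂ (Fin n)) :
    inner ℂ y (WithLp.toLp 2 (A *ᵥ v.ofLp)) = μ * inner ℂ y v := by
  rw [EuclideanSpace.inner_eq_star_dotProduct, EuclideanSpace.inner_eq_star_dotProduct,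
    dotProduct_comm, Matrix.dotProduct_mulVec, hy.2, smul_dotProduct, smul_eq_mul, dotProduct_comm]

theorem IsUnitLeftEigenvector.inner_residual {A : Matrix (Fin n) (Fin n) ℂ} {μ z : ℂ}
    {y : EuclideanSpace ℂ (Fin n)} (hy : IsUnitLeftEigenvector A μ y)
    {u v : EuclideanSpace ℂ (Fin n)} (h : A *ᵥ v.ofLp + u.ofLp = z • v.ofLp) :
    (z - μ) * inner ℂ y v = inner ℂ y u := by
  have h1 : WithLp.toLp 2 (A *ᵥ v.ofLp) + u = z • v := by
    have := congrArg (WithLp.toLp 2) h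
    simpa using this
  have h2 := congrArg (inner ℂ y) h1
  rw [inner_add_right, hy.inner_mulVec, inner_smul_right] at h2
  linear_combination -h2

theorem inner_eq_zero_of_ne {A : Matrix (Fin n) (Fin n) ℂ} {μ ν : ℂ}
    {x y : EuclideanSpace ℂ (Fin n)} (hy : IsUnitLeftEigenvector A μ y)
    (hx : IsUnitRightEigenvector A ν x) (hne : ν ≠ μ) : inner ℂ y x = 0 := by
  have h := hy.inner_residual (z := ν) (u := 0) (v := x) (by simpa using hx.2)
  rw [inner_zero_right] at h
  exact (mul_eq_zero.1 h).resolve_left (sub_ne_zero.2 hne)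

/-- A choice of unit right and left eigenvectors for every eigenvalue. -/
def IsUnitEigensystem (A : Matrix (Fin n) (Fin n) ℂ) (x y : ℂ → EuclideanSpace ℂ (Fin n)) : Prop :=
  ∀ μ ∈ spectrum ℂ A, IsUnitRightEigenvector A μ (x μ) ∧ IsUnitLeftEigenvector A μ (y μ)

/-! ### Biorthogonal eigenvector expansion -/

namespace IsUnitEigensystem

variable {A : Matrix (Fin n) (Fin n) ℂ} {x y : ℂ → EuclideanSpace ℂ (Fin n)}

theorem exists_sum_smul (hxy : IsUnitEigensystem A x y)
    (hA : ∀ μ₀ ∈ spectrum ℂ A, IsSimpleEigenvalue A μ₀) (v : EuclideanSpace ℂ (Fin n)) :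
    ∃ c : ℂ → ℂ, v = ∑ μ ∈ A.charpoly.roots.toFinset, c μ • x μ := by
  set S := A.charpoly.roots.toFinset with hS
  have hli : LinearIndependent ℂ fun μ : S => x μ := by
    refine Module.End.eigenvectors_linearIndependent' (Matrix.toEuclideanLin A) (fun μ : S => (μ : ℂ))
      Subtype.val_injective _ fun μ => ?_
    have hx := (hxy μ (mem_toFinset_roots.1 μ.2)).1
    refine Module.End.hasEigenvector_iff.2 ⟨Module.End.mem_eigenspace_iff.2 ?_, ?_⟩
    · rw [Matrix.toLpLin_apply, hx.2]
      simp
    · exact norm_pos_iff.1 (by rw [hx.1]; exact one_pos)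
  have hcard : Fintype.card S = Module.finrank ℂ (EuclideanSpace ℂ (Fin n)) := by
    rw [Fintype.card_coe, card_toFinset_roots hA, finrank_euclideanSpace_fin]
  have hspan := hli.span_eq_top_of_card_eq_finrank' hcard
  have hv : v ∈ Submodule.span ℂ (Set.range fun μ : S => x μ) := hspan ▸ Submodule.mem_top
  obtain ⟨c, hc⟩ := (Submodule.mem_span_range_iff_exists_fun ℂ).1 hv
  refine ⟨fun μ => if h : μ ∈ S then c ⟨μ, h⟩ else 0, ?_⟩
  rw [← hc, ← Finset.sum_coe_sort S]
  simp

theorem inner_sum_smul (hxy : IsUnitEigensystem A x y) {μ : ℂ} (hμ : μ ∈ spectrum ℂ A)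
    {y' : EuclideanSpace ℂ (Fin n)} (hy' : IsUnitLeftEigenvector A μ y') (c : ℂ → ℂ) :
    inner ℂ y' (∑ ν ∈ A.charpoly.roots.toFinset, c ν • x ν) = c μ * inner ℂ y' (x μ) := by
  rw [inner_sum, Finset.sum_eq_single_of_mem μ (mem_toFinset_roots.2 hμ), inner_smul_right]
  intro ν hν hne
  rw [inner_smul_right,
    inner_eq_zero_of_ne hy' (hxy ν (mem_toFinset_roots.1 hν)).1 hne, mul_zero]

/-- Expand `y μ` in right eigenvectors: biorthogonality leaves only the `x μ` term in `⟨y μ, y μ⟩`,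
so a vanishing pairing would force `y μ = 0`. -/
theorem inner_ne_zero (hxy : IsUnitEigensystem A x y)
    (hA : ∀ μ₀ ∈ spectrum ℂ A, IsSimpleEigenvalue A μ₀) {μ : ℂ} (hμ : μ ∈ spectrum ℂ A) :
    inner ℂ (y μ) (x μ) ≠ 0 := by
  intro h0
  obtain ⟨c, hc⟩ := hxy.exists_sum_smul hA (y μ)
  have h1 := hxy.inner_sum_smul hμ (hxy μ hμ).2 c
  rw [← hc, h0, mul_zero, inner_self_eq_zero] at h1
  have h2 := (hxy μ hμ).2.1
  rw [h1, norm_zero] at h2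
  exact zero_ne_one h2

theorem eq_sum (hxy : IsUnitEigensystem A x y)
    (hA : ∀ μ₀ ∈ spectrum ℂ A, IsSimpleEigenvalue A μ₀) (v : EuclideanSpace ℂ (Fin n)) :
    v = ∑ μ ∈ A.charpoly.roots.toFinset, (inner ℂ (y μ) v / inner ℂ (y μ) (x μ)) • x μ := by
  obtain ⟨c, hc⟩ := hxy.exists_sum_smul hA v
  conv_lhs => rw [hc]
  refine Finset.sum_congr rfl fun μ hμ => ?_
  have hμ' := mem_toFinset_roots.1 hμ
  congr 1
  rw [eq_div_iff (hxy.inner_ne_zero hA hμ'), ← hxy.inner_sum_smul hμ' (hxy μ hμ').2, ← hc]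

/-- `|y* x|` does not depend on the choice of the unit eigenvectors. -/
theorem norm_inner_eq (hxy : IsUnitEigensystem A x y)
    (hA : ∀ μ₀ ∈ spectrum ℂ A, IsSimpleEigenvalue A μ₀) {μ : ℂ} (hμ : μ ∈ spectrum ℂ A)
    {x' y' : EuclideanSpace ℂ (Fin n)} (hx' : IsUnitRightEigenvector A μ x')
    (hy' : IsUnitLeftEigenvector A μ y') : ‖inner ℂ y' x'‖ = ‖inner ℂ (y μ) (x μ)‖ := by
  have hne := hxy.inner_ne_zero hA hμ
  have hx : x' = (inner ℂ (y μ) x' / inner ℂ (y μ) (x μ)) • x μ := by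
    conv_lhs => rw [hxy.eq_sum hA x']
    refine Finset.sum_eq_single_of_mem μ (mem_toFinset_roots.2 hμ) fun ν hν hνμ => ?_
    rw [inner_eq_zero_of_ne (hxy ν (mem_toFinset_roots.1 hν)).2 hx' hνμ.symm, zero_div, zero_smul]
  have hxn : ‖inner ℂ (y μ) x'‖ = ‖inner ℂ (y μ) (x μ)‖ := by
    have h := congrArg norm hx
    rw [norm_smul, hx'.1, (hxy μ hμ).1.1, mul_one, norm_div] at h
    exact ((div_eq_one_iff_eq (norm_ne_zero_iff.2 hne)).1 h.symm)
  set d := inner ℂ y' (x μ) / inner ℂ (y μ) (x μ) with hd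
  have hyd : ∀ w, inner ℂ y' w = d * inner ℂ (y μ) w := by
    intro w
    conv_lhs => rw [hxy.eq_sum hA w]
    rw [hxy.inner_sum_smul hμ hy', hd]
    ring
  have hy : y' = starRingEnd ℂ d • y μ :=
    ext_inner_right ℂ fun w => by rw [hyd, inner_smul_left, Complex.conj_conj]
  have hdn : ‖d‖ = 1 := by
    have h := congrArg norm hy
    rwa [norm_smul, hy'.1, (hxy μ hμ).2.1, mul_one, RCLike.norm_conj, eq_comm] at h
  rw [hyd, norm_mul, hdn, one_mul, hxn]

/-! ### First-order estimates -/

theorem norm_coeff_smul (hxy : IsUnitEigensystem A x y) {μ : ℂ} (hμ : μ ∈ spectrum ℂ A)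
    (v : EuclideanSpace ℂ (Fin n)) :
    ‖(inner ℂ (y μ) v / inner ℂ (y μ) (x μ)) • x μ‖ =
      1 / ‖inner ℂ (y μ) (x μ)‖ * ‖inner ℂ (y μ) v‖ := by
  rw [norm_smul, (hxy μ hμ).1.1, mul_one, norm_div, div_mul_eq_mul_div, one_mul]

/-- Each pseudo-eigenvalue lies close to an eigenvalue, to first order within its condition number
times `ε`. -/
theorem exists_norm_sub_le_of_mem_pseudospectrum (hn : 0 < n) (hxy : IsUnitEigensystem A x y)
    (hA : ∀ μ₀ ∈ spectrum ℂ A, IsSimpleEigenvalue A μ₀) {g K ε : ℝ} (hg : 0 < g)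
    (hsep : ∀ μ ∈ spectrum ℂ A, ∀ ν ∈ spectrum ℂ A, μ ≠ ν → g ≤ dist μ ν)
    (hK : K = ∑ μ ∈ A.charpoly.roots.toFinset, 1 / ‖inner ℂ (y μ) (x μ)‖)
    (hεK : K * ε ≤ g / 2) {z : ℂ} (hz : z ∈ pseudospectrum A ε) :
    ∃ μ ∈ spectrum ℂ A,
      ‖z - μ‖ ≤ ε * (1 / ‖inner ℂ (y μ) (x μ)‖) + 2 * K ^ 2 / g * ε ^ 2 := by
  set S := A.charpoly.roots.toFinset with hS
  set κ : ℂ → ℝ := fun μ => 1 / ‖inner ℂ (y μ) (x μ)‖ with hκ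
  have hκ0 : ∀ μ, 0 ≤ κ μ := fun μ => by positivity
  have hK0 : 0 ≤ K := hK ▸ Finset.sum_nonneg fun μ _ => hκ0 μ
  obtain ⟨Δ, hΔ, hz⟩ := hz
  have hε0 : 0 ≤ ε := (norm_nonneg Δ).trans hΔ
  obtain ⟨v, hv, hzv⟩ := exists_eigenvector hz
  have hv0 : 0 < ‖v‖ := norm_pos_iff.2 hv
  set u := WithLp.toLp 2 (Δ *ᵥ v.ofLp) with hu
  have hres : A *ᵥ v.ofLp + u.ofLp = z • v.ofLp := by rw [← hzv, Matrix.add_mulVec]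
  have hun : ‖u‖ ≤ ε * ‖v‖ := (norm_toLp_mulVec_le Δ v).trans (by gcongr)
  have ha : ∀ μ ∈ S, ‖z - μ‖ * ‖inner ℂ (y μ) v‖ ≤ ε * ‖v‖ := by
    intro μ hμ
    have hy := (hxy μ (mem_toFinset_roots.1 hμ)).2
    rw [← norm_mul, hy.inner_residual hres]
    refine (norm_inner_le_norm _ _).trans ?_
    rwa [hy.1, one_mul]
  have hvle : ‖v‖ ≤ ∑ μ ∈ S, κ μ * ‖inner ℂ (y μ) v‖ := by
    conv_lhs => rw [hxy.eq_sum hA v]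
    refine (norm_sum_le _ _).trans (Finset.sum_le_sum fun μ hμ => ?_)
    rw [hxy.norm_coeff_smul (mem_toFinset_roots.1 hμ)]
  obtain ⟨μ, hμ, hmin⟩ := Finset.exists_min_image S (fun μ => ‖z - μ‖)
    ((spectrum_nonempty hn A).imp fun _ => mem_toFinset_roots.2)
  set d := ‖z - μ‖ with hd
  have hd0 : 0 ≤ d := norm_nonneg _
  -- A Bauer–Fike type bound for the nearest eigenvalue `μ`. It places every other eigenvalue at
  -- distance at least `g / 2` from `z`.
  have hdK : d ≤ K * ε := by
    refine le_of_mul_le_mul_right ?_ hv0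
    calc d * ‖v‖ ≤ d * ∑ ν ∈ S, κ ν * ‖inner ℂ (y ν) v‖ := by gcongr
      _ = ∑ ν ∈ S, κ ν * (d * ‖inner ℂ (y ν) v‖) := by
        rw [Finset.mul_sum]
        exact Finset.sum_congr rfl fun ν _ => by ring
      _ ≤ ∑ ν ∈ S, κ ν * (ε * ‖v‖) := Finset.sum_le_sum fun ν hν =>
        mul_le_mul_of_nonneg_left ((mul_le_mul_of_nonneg_right (hmin ν hν) (norm_nonneg _)).trans
          (ha ν hν)) (hκ0 ν)
      _ = K * ε * ‖v‖ := by rw [← Finset.sum_mul, hK]; ring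
  have hfar : ∀ ν ∈ S.erase μ, ‖inner ℂ (y ν) v‖ ≤ 2 * ε / g * ‖v‖ := by
    intro ν hν
    obtain ⟨hne, hν⟩ := Finset.mem_erase.1 hν
    have h1 := hsep μ (mem_toFinset_roots.1 hμ) ν (mem_toFinset_roots.1 hν) hne.symm
    have h2 : dist μ ν ≤ d + ‖z - ν‖ := by
      rw [hd, ← dist_eq_norm, ← dist_eq_norm, dist_comm z μ]
      exact dist_triangle μ z ν
    have h3 : g / 2 ≤ ‖z - ν‖ := by linarith
    have h4 : g / 2 * ‖inner ℂ (y ν) v‖ ≤ ε * ‖v‖ :=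
      (mul_le_mul_of_nonneg_right h3 (norm_nonneg _)).trans (ha ν hν)
    rw [div_mul_eq_mul_div, le_div_iff₀ hg]
    linarith
  refine ⟨μ, mem_toFinset_roots.1 hμ, le_of_mul_le_mul_right ?_ hv0⟩
  have hrest : ∑ ν ∈ S.erase μ, κ ν * ‖inner ℂ (y ν) v‖ ≤ K * (2 * ε / g * ‖v‖) := by
    rw [hK, Finset.sum_mul]
    refine (Finset.sum_le_sum fun ν hν => mul_le_mul_of_nonneg_left (hfar ν hν) (hκ0 ν)).trans ?_
    exact Finset.sum_le_sum_of_subset_of_nonneg (Finset.erase_subset _ _) fun ν _ _ =>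
      mul_nonneg (hκ0 ν) (by positivity)
  -- Bootstrap: the `μ` term gives the sharp coefficient, while in the other terms the crude `d ≤ K
  -- * ε` meets components of size `O(ε)`, hence the `ε ^ 2`.
  calc d * ‖v‖ ≤ d * ∑ ν ∈ S, κ ν * ‖inner ℂ (y ν) v‖ := by gcongr
    _ = κ μ * (d * ‖inner ℂ (y μ) v‖) + d * ∑ ν ∈ S.erase μ, κ ν * ‖inner ℂ (y ν) v‖ := by
      rw [← Finset.add_sum_erase S _ hμ]
      ring
    _ ≤ κ μ * (ε * ‖v‖) + K * ε * (K * (2 * ε / g * ‖v‖)) :=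
      add_le_add (mul_le_mul_of_nonneg_left (ha μ hμ) (hκ0 μ))
        (mul_le_mul hdK hrest (Finset.sum_nonneg fun ν _ =>
          mul_nonneg (hκ0 ν) (norm_nonneg _)) (by positivity))
    _ = (ε * κ μ + 2 * K ^ 2 / g * ε ^ 2) * ‖v‖ := by ring

/-- The `ε`-pseudospectrum reaches, to first order, as far to the right of each eigenvalue as its
condition number times `ε`. -/
theorem exists_mem_pseudospectrum_re_ge (hxy : IsUnitEigensystem A x y)
    (hA : ∀ μ₀ ∈ spectrum ℂ A, IsSimpleEigenvalue A μ₀) {g K ε : ℝ} (hg : 0 < g) (hε : 0 < ε)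
    (hsep : ∀ μ ∈ spectrum ℂ A, ∀ ν ∈ spectrum ℂ A, μ ≠ ν → g ≤ dist μ ν)
    (hK : K = ∑ μ ∈ A.charpoly.roots.toFinset, 1 / ‖inner ℂ (y μ) (x μ)‖)
    (hεK : K * ε ≤ g / 2) {μ : ℂ} (hμ : μ ∈ spectrum ℂ A) :
    ∃ z ∈ pseudospectrum A ε,
      μ.re + ε * (1 / ‖inner ℂ (y μ) (x μ)‖) - 2 * K ^ 2 / g * ε ^ 2 ≤ z.re := by
  set S := A.charpoly.roots.toFinset with hS
  set κ : ℂ → ℝ := fun μ => 1 / ‖inner ℂ (y μ) (x μ)‖ with hκ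
  have hκ0 : ∀ μ, 0 ≤ κ μ := fun μ => by positivity
  have hκpos : 0 < κ μ := one_div_pos.2 (norm_pos_iff.2 (hxy.inner_ne_zero hA hμ))
  have hμS : μ ∈ S := mem_toFinset_roots.2 hμ
  have hκK : κ μ ≤ K := hK ▸ Finset.single_le_sum (fun ν _ => hκ0 ν) hμS
  have hK0 : 0 < K := hκpos.trans_le hκK
  have hden : 0 < 1 + 2 * K * ε / g := by positivity
  -- This `t` solves `κ μ / t = 1 / ε + 2 * K / g`: the `μ` component of the vector `v` below has
  -- norm `κ μ / t` and the rest at most `2 * K / g`, so `‖v‖ ≥ 1 / ε`.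
  set t : ℝ := κ μ * ε / (1 + 2 * K * ε / g) with ht
  have ht0 : 0 < t := by positivity
  have htle : t ≤ g / 2 := by
    refine le_trans ?_ hεK
    refine (div_le_self (by positivity) ?_).trans (by gcongr)
    exact le_add_of_nonneg_right (by positivity)
  have htge : ε * κ μ - 2 * K ^ 2 / g * ε ^ 2 ≤ t := by
    rw [ht, le_div_iff₀ hden]
    have h1 : (ε * κ μ - 2 * K ^ 2 / g * ε ^ 2) * (1 + 2 * K * ε / g) = κ μ * ε -
        (2 * K / g * ε ^ 2 * (K - κ μ) + 2 * K ^ 2 / g * ε ^ 2 * (2 * K * ε / g)) := by ring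
    rw [h1]
    have h2 : 0 ≤ 2 * K / g * ε ^ 2 * (K - κ μ) :=
      mul_nonneg (by positivity) (sub_nonneg.2 hκK)
    have h3 : 0 ≤ 2 * K ^ 2 / g * ε ^ 2 * (2 * K * ε / g) := by positivity
    linarith
  set z : ℂ := μ + t with hz
  have hzμ : ‖z - μ‖ = t := by rw [hz, add_sub_cancel_left, Complex.norm_of_nonneg ht0.le]
  have hfar : ∀ ν ∈ S, ν ≠ μ → g / 2 ≤ ‖z - ν‖ := by
    intro ν hν hne
    have h1 := hsep μ hμ ν (mem_toFinset_roots.1 hν) hne.symm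
    have h2 : dist μ ν ≤ t + ‖z - ν‖ := by
      rw [← hzμ, ← dist_eq_norm, ← dist_eq_norm, dist_comm z μ]
      exact dist_triangle μ z ν
    linarith
  have hzS : z ∉ spectrum ℂ A := by
    intro h
    by_cases hzz : z = μ
    · rw [hzz, sub_self, norm_zero] at hzμ
      exact ht0.ne hzμ
    · have h1 := hfar z (mem_toFinset_roots.2 h) hzz
      rw [sub_self, norm_zero] at h1
      linarith
  have hunit : IsUnit (algebraMap ℂ (Matrix (Fin n) (Fin n) ℂ) z - A) :=
    not_not.1 fun h => hzS (spectrum.mem_iff.2 h)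
  -- Taking the residual to be `y μ` makes its pairing with `y μ` equal to `1`, so the `μ` component
  -- of `v` is known exactly.
  obtain ⟨v', hv'⟩ := Matrix.mulVec_surjective_iff_isUnit.2 hunit (y μ).ofLp
  set v : EuclideanSpace ℂ (Fin n) := WithLp.toLp 2 v' with hvdef
  have hres : A *ᵥ v.ofLp + (y μ).ofLp = z • v.ofLp := by
    rw [← hv', Matrix.sub_mulVec, Algebra.algebraMap_eq_smul_one, Matrix.smul_mulVec,
      Matrix.one_mulVec]
    exact add_sub_cancel _ _
  have ha : ∀ ν ∈ S, ‖z - ν‖ * ‖inner ℂ (y ν) v‖ ≤ 1 := by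
    intro ν hν
    have hy := (hxy ν (mem_toFinset_roots.1 hν)).2
    rw [← norm_mul, hy.inner_residual hres]
    refine (norm_inner_le_norm _ _).trans ?_
    rw [hy.1, (hxy μ hμ).2.1, one_mul]
  have haμ : t * ‖inner ℂ (y μ) v‖ = 1 := by
    rw [← hzμ, ← norm_mul, (hxy μ hμ).2.inner_residual hres, inner_self_eq_norm_sq_to_K,
      (hxy μ hμ).2.1]
    simp
  have hrest : ‖∑ ν ∈ S.erase μ, (inner ℂ (y ν) v / inner ℂ (y ν) (x ν)) • x ν‖ ≤ 2 * K / g := by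
    have h1 : ∀ ν ∈ S.erase μ, ‖(inner ℂ (y ν) v / inner ℂ (y ν) (x ν)) • x ν‖ ≤
        κ ν * (2 / g) := by
      intro ν hν
      obtain ⟨hne, hν⟩ := Finset.mem_erase.1 hν
      rw [hxy.norm_coeff_smul (mem_toFinset_roots.1 hν)]
      refine mul_le_mul_of_nonneg_left ?_ (hκ0 ν)
      rw [le_div_iff₀ hg]
      have h2 := (mul_le_mul_of_nonneg_right (hfar ν hν hne) (norm_nonneg (inner ℂ (y ν) v))).trans
        (ha ν hν)
      linarith
    calc _ ≤ ∑ ν ∈ S.erase μ, κ ν * (2 / g) := norm_sum_le_of_le _ h1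
      _ ≤ ∑ ν ∈ S, κ ν * (2 / g) :=
        Finset.sum_le_sum_of_subset_of_nonneg (Finset.erase_subset _ _) fun ν _ _ =>
          mul_nonneg (hκ0 ν) (by positivity)
      _ = 2 * K / g := by rw [← Finset.sum_mul, ← hK]; ring
  have hvge : 1 ≤ ε * ‖v‖ := by
    have h1 : κ μ * ‖inner ℂ (y μ) v‖ ≤ ‖v‖ + 2 * K / g := by
      rw [← hxy.norm_coeff_smul hμ]
      have h2 := hxy.eq_sum hA v
      rw [← Finset.add_sum_erase _ _ hμS] at h2
      calc _ = ‖v - ∑ ν ∈ S.erase μ, (inner ℂ (y ν) v / inner ℂ (y ν) (x ν)) • x ν‖ := by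
            rw [eq_sub_of_add_eq h2.symm]
        _ ≤ ‖v‖ + 2 * K / g := (norm_sub_le _ _).trans (by gcongr)
    have h3 : ε * (κ μ * ‖inner ℂ (y μ) v‖) = 1 + 2 * K * ε / g := by
      have h4 : κ μ * ε = t * (1 + 2 * K * ε / g) := by rw [ht, div_mul_cancel₀ _ hden.ne']
      linear_combination ‖inner ℂ (y μ) v‖ * h4 + (1 + 2 * K * ε / g) * haμ
    have h5 := mul_le_mul_of_nonneg_left h1 hε.le
    rw [h3] at h5
    have h6 : ε * (2 * K / g) = 2 * K * ε / g := by ring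
    linarith
  refine ⟨z, mem_pseudospectrum_of_residual (v := v) ?_ hres (by rwa [(hxy μ hμ).2.1]), ?_⟩
  · intro h
    rw [h, norm_zero, mul_zero] at hvge
    linarith
  · rw [hz, Complex.add_re, Complex.ofReal_re]
    linarith

theorem exists_abs_sub_le (hn : 0 < n) (hxy : IsUnitEigensystem A x y)
    (hA : ∀ μ₀ ∈ spectrum ℂ A, IsSimpleEigenvalue A μ₀) :
    ∃ C : ℝ, ∀ ε : ℝ, 0 < ε → ∀ α M : ℝ, IsGreatest (Complex.re '' pseudospectrum A ε) α →
      IsGreatest ((fun μ : ℂ => μ.re + ε * (1 / ‖inner ℂ (y μ) (x μ)‖)) '' spectrum ℂ A) M →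
      |α - M| ≤ C * ε ^ 2 := by
  obtain ⟨g, hg, hsep⟩ := exists_pos_le_dist A.charpoly.roots.toFinset
  simp only [mem_toFinset_roots] at hsep
  obtain ⟨K, hK⟩ : ∃ K, K = ∑ μ ∈ A.charpoly.roots.toFinset, 1 / ‖inner ℂ (y μ) (x μ)‖ := ⟨_, rfl⟩
  have hK0 : 0 ≤ K := hK ▸ Finset.sum_nonneg fun μ _ => by positivity
  -- Below this threshold `K * ε ≤ g / 2`, as both estimates require; `K + 1` keeps the denominator
  -- positive.
  set δ := g / (2 * (K + 1)) with hδ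
  have hδ0 : 0 < δ := by positivity
  refine ⟨2 * K ^ 2 / g + (2 * ‖A‖ / δ ^ 2 + (K + 1) / δ), fun ε hε α M hα hM => ?_⟩
  have hC1 : 0 ≤ 2 * K ^ 2 / g * ε ^ 2 := by positivity
  have hC2 : 0 ≤ (2 * ‖A‖ / δ ^ 2 + (K + 1) / δ) * ε ^ 2 := by positivity
  obtain ⟨μ, hμ, hμM⟩ := hM.1
  obtain ⟨z, hz, hzα⟩ := hα.1
  dsimp only at hμM
  rw [add_mul]
  rcases le_total ε δ with h | h
  · have hεK : K * ε ≤ g / 2 := by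
      calc K * ε ≤ (K + 1) * δ := by gcongr; linarith
        _ = g / 2 := by rw [hδ]; field_simp
    obtain ⟨ν, hν, hzν⟩ :=
      hxy.exists_norm_sub_le_of_mem_pseudospectrum hn hA hg hsep hK hεK hz
    obtain ⟨w, hw, hwre⟩ := hxy.exists_mem_pseudospectrum_re_ge hA hg hε hsep hK hεK hμ
    have h1 : ν.re + ε * (1 / ‖inner ℂ (y ν) (x ν)‖) ≤ M := hM.2 ⟨ν, hν, rfl⟩
    have h2 : w.re ≤ α := hα.2 ⟨w, hw, rfl⟩
    have h3 : z.re - ν.re ≤ ‖z - ν‖ := by simpa using Complex.re_le_norm (z - ν)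
    rw [abs_le]
    constructor <;> linarith
  -- For `ε ≥ δ` the trivial bound `2 * ‖A‖ + (K + 1) * ε` suffices, since factors `ε / δ ≥ 1` raise
  -- it to order `ε ^ 2`. Thus `C` serves all `ε > 0`.
  · have h1 : |z.re| ≤ ‖A‖ + ε := (Complex.abs_re_le_norm z).trans (norm_le_of_mem_pseudospectrum hz)
    have h2 : |μ.re| ≤ ‖A‖ := (Complex.abs_re_le_norm μ).trans (norm_le_of_mem_spectrum hμ)
    have h3 : 1 / ‖inner ℂ (y μ) (x μ)‖ ≤ K :=
      hK ▸ Finset.single_le_sum (f := fun μ => 1 / ‖inner ℂ (y μ) (x μ)‖)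
        (fun ν _ => by positivity) (mem_toFinset_roots.2 hμ)
    have h4 : ε * (1 / ‖inner ℂ (y μ) (x μ)‖) ≤ ε * K := by gcongr
    have h5 : 0 ≤ ε * (1 / ‖inner ℂ (y μ) (x μ)‖) := by positivity
    have h6 : 1 ≤ ε / δ := (one_le_div hδ0).2 h
    have h7 : 2 * ‖A‖ ≤ 2 * ‖A‖ * (ε / δ) ^ 2 :=
      le_mul_of_one_le_right (by positivity) (one_le_pow₀ h6)
    have h8 : (K + 1) * ε ≤ (K + 1) * ε * (ε / δ) := le_mul_of_one_le_right (by positivity) h6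
    have h9 : (2 * ‖A‖ / δ ^ 2 + (K + 1) / δ) * ε ^ 2 =
        2 * ‖A‖ * (ε / δ) ^ 2 + (K + 1) * ε * (ε / δ) := by ring
    have h10 : 0 ≤ K * ε := by positivity
    rw [abs_le] at h1 h2 ⊢
    constructor <;> linarith [h1.1, h1.2, h2.1, h2.2]

end IsUnitEigensystem

end PsAbscissa

theorem mainTheorem2 (n : ℕ) (hn : 0 < n) (A : Matrix (Fin n) (Fin n) ℂ)
    (hA : ∀ μ₀ ∈ spectrum ℂ A, PsAbscissa.IsSimpleEigenvalue A μ₀) :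
    -- the smallness condition holds for all small `ε`
    (∃ ε₀ : ℝ, 0 < ε₀ ∧ ∀ ε : ℝ, 0 < ε → ε ≤ ε₀ →
      ∃ (U : Set ℝ) (r : ℂ → ℝ), PsAbscissa.IsSufficientlySmall A ε U r) ∧
    -- first equality; all maxima involved exist
    (∀ (ε : ℝ) (U : Set ℝ) (r : ℂ → ℝ), PsAbscissa.IsSufficientlySmall A ε U r →
      IsGreatest (Complex.re '' PsAbscissa.pseudospectrum A ε)
        (PsAbscissa.pseudospectralAbscissa A ε) ∧
      (∀ μ₀ ∈ spectrum ℂ A, IsGreatest (PsAbscissa.branchReals A (r μ₀) ε μ₀)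
        (PsAbscissa.rightmostReal A (r μ₀) ε μ₀)) ∧
      IsGreatest ((fun μ₀ : ℂ => PsAbscissa.rightmostReal A (r μ₀) ε μ₀) '' spectrum ℂ A)
        (PsAbscissa.pseudospectralAbscissa A ε)) ∧
    -- second equality, with a constant depending only on `A`
    (∃ C : ℝ, ∀ x y : ℂ → EuclideanSpace ℂ (Fin n),
      (∀ μ₀ ∈ spectrum ℂ A, PsAbscissa.IsUnitRightEigenvector A μ₀ (x μ₀) ∧
        PsAbscissa.IsUnitLeftEigenvector A μ₀ (y μ₀)) →
      ∀ (ε : ℝ) (U : Set ℝ) (r : ℂ → ℝ), PsAbscissa.IsSufficientlySmall A ε U r →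
        ∃ M : ℝ,
          IsGreatest ((fun μ₀ : ℂ => μ₀.re + ε * (1 / ‖inner ℂ (y μ₀) (x μ₀)‖)) '' spectrum ℂ A)
            M ∧
          |PsAbscissa.pseudospectralAbscissa A ε - M| ≤ C * ε ^ 2) := by
  refine ⟨PsAbscissa.exists_isSufficientlySmall hA, fun ε U r hs => ?_, ?_⟩
  · have h := hs.isGreatest_pseudospectralAbscissa hn hA
    exact ⟨h.1, fun μ₀ hμ₀ => hs.isGreatest_rightmostReal hμ₀, h.2⟩
  -- `C` must precede the eigenvectors, so it is taken from one fixed system and transferred by the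
  -- invariance of `|y* x|`; if no system exists, the claim is vacuous.
  by_cases hex : ∃ x y, PsAbscissa.IsUnitEigensystem A x y
  · obtain ⟨x₀, y₀, hxy₀⟩ := hex
    obtain ⟨C, hC⟩ := hxy₀.exists_abs_sub_le hn hA
    refine ⟨C, fun x y hxy ε U r hs => ?_⟩
    obtain ⟨M, hM⟩ := PsAbscissa.isGreatest_image_spectrum hn A
      fun μ₀ => μ₀.re + ε * (1 / ‖inner ℂ (y μ₀) (x μ₀)‖)
    refine ⟨M, hM, hC ε hs.pos _ M (hs.isGreatest_pseudospectralAbscissa hn hA).1 ?_⟩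
    rwa [Set.image_congr fun μ hμ => ?_]
    rw [hxy₀.norm_inner_eq hA hμ (hxy μ hμ).1 (hxy μ hμ).2]
  · exact ⟨0, fun x y hxy => absurd ⟨x, y, hxy⟩ hex⟩
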